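/- Let $a<b$ be real, $0<\alpha<1$, $x\in[a,b]$, and let $\bar n, m\ge 1$ be integers. *Operators.* Put $\varphi(t)=t\,(1+t^{2m})^{-1/(2m)}$ and $\Phi(t)=\frac14[\varphi(t+1)-\varphi(t-1)]$ for $t\in\mathbb R$. For $n\in\mathbb N$ with $\lceil na\rceil\le\lfloor nb\rfloor$ put $$A_nf(x)=\frac{\sum_{k=\lceil na\rceil}^{\lfloor nb\rfloor} f(k/n)\,\Phi(nx-k)}{\sum_{k=\lceil na\rceil}^{\lfloor nb\rfloor}\Phi(nx-k)}.$$ *Caputo derivatives.* For an absolutely continuous $g$ on $[x,b]$, resp. on $[a,x]$, let $$D_{*x}^{\alpha}g(y)=\frac1{\Gamma(1-\alpha)}\int_x^y (y-t)^{-\alpha}g'(t)\,dt\quad(x\le y\le b),$$ $$D_{x-}^{\alpha}g(y)=\frac{-1}{\Gamma(1-\alpha)}\int_y^x (t-y)^{-\alpha}g'(t)\,dt\quad(a\le y\le x),$$ and let $D_{*x}^{k\alpha}$, $D_{x-}^{k\alpha}$ be the $k$-fold iterates of these operators ($k=0$: the identity). For $\delta>0$ and $g$ continuous on an interval $I$ let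 $\omega_1(g,\delta)_I=\sup\{|g(y)-g(z)|: y,z\in I,\ |y-z|\le\delta\}$, and let $$\omega_1\big(D_x^{(\bar n+1)\alpha}f,\delta\big)=\max\Big\{\omega_1\big(D_{*x}^{(\bar n+1)\alpha}f,\delta\big)_{[x,b]},\ \omega_1\big(D_{x-}^{(\bar n+1)\alpha}f,\delta\big)_{[a,x]}\Big\}.$$ *Hypotheses.* Let $f:[a,b]\to\mathbb R$ be absolutely continuous with $f'\in L_\infty([a,b])$. Assume that $D_{*x}^{k\alpha}f$ is absolutely continuous on $[x,b]$ and $D_{x-}^{k\alpha}f$ is absolutely continuous on $[a,x]$ for $k=1,\dots,\bar n$ (so that the iterated derivatives are defined), that $D_{*x}^{k\alpha}f\in C([x,b])$ and $D_{x-}^{k\alpha}f\in C([a,x])$ for $k=0,1,\dots,\bar n+1$, and that $D_{*x}^{i\alpha}f(x)=0=D_{x-}^{i\alpha}f(x)$ for $i=2,\dots,\bar n+1$. *Conclusion.* For every $n\in\mathbb N$ with $n^{1-\alpha}>2$ and $\lceil na\rceil\le\lfloor nb\rfloor$ and every $\delta>0$, $$|A_nf(x)-f(x)|\le\frac{2\,(1+4^m)^{1/(2m)}\;\omega_1\big(D_x^{(\bar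 n+1)\alpha}f,\delta\big)}{\Gamma((\bar n+1)\alpha+1)}\Bigg\{\frac1{n^{(\bar n+1)\alpha^2}}+\frac{(b-a)^{(\bar n+1)\alpha}}{4m\,(n^{1-\alpha}-2)^{2m}}$$ $$\qquad+\frac1{\delta((\bar n+1)\alpha+1)}\bigg[\frac1{n^{\alpha[(\bar n+1)\alpha+1]}}+\frac{(b-a)^{(\bar n+1)\alpha+1}}{4m\,(n^{1-\alpha}-2)^{2m}}\bigg]\Bigg\}.$$ Consequently $\lim_{n\to\infty}A_nf(x)=f(x)$. -/

import Mathlib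

noncomputable section

/-- The generator function `φ(x) = x / (1 + x ^ (2m)) ^ (1 / (2m))`. -/
def sigmoidGen (m : ℕ) (x : ℝ) : ℝ :=
  x / (1 + x ^ (2 * m)) ^ (1 / (2 * (m : ℝ)))

/-- The activation function `Φ(x) = (φ(x + 1) - φ(x - 1)) / 4`. -/
def activation (m : ℕ) (x : ℝ) : ℝ :=
  (1 / 4) * (sigmoidGen m (x + 1) - sigmoidGen m (x - 1))

/-- The normalized neural network operator `A_n(f, x)` on `[a, b]`. It is meant for those `n` with
`⌈n a⌉ ≤ ⌊n b⌋`, i.e. such that some `k / n` lies in `[a, b]`. -/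
def neuralOp (m : ℕ) (a b : ℝ) (n : ℕ) (f : ℝ → ℝ) (x : ℝ) : ℝ :=
  (∑ k ∈ Finset.Icc ⌈(n : ℝ) * a⌉ ⌊(n : ℝ) * b⌋,
      f ((k : ℝ) / (n : ℝ)) * activation m ((n : ℝ) * x - (k : ℝ))) /
    ∑ k ∈ Finset.Icc ⌈(n : ℝ) * a⌉ ⌊(n : ℝ) * b⌋, activation m ((n : ℝ) * x - (k : ℝ))

/-- The first modulus of continuity `ω₁(g, δ)` over the set `s`. -/
def modulusOn (s : Set ℝ) (g : ℝ → ℝ) (δ : ℝ) : ℝ :=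
  sSup {r : ℝ | ∃ y ∈ s, ∃ z ∈ s, |y - z| ≤ δ ∧ r = |g y - g z|}

/-- The left Caputo derivative of order `0 < α < 1` with anchor `x`, set to `0` left of `x`.
The integrand only involves the derivative of `g` at points between `x` and `y`. -/
def caputoLeft (α x : ℝ) (g : ℝ → ℝ) (y : ℝ) : ℝ :=
  if x ≤ y then (1 / Real.Gamma (1 - α)) * ∫ t in x..y, (y - t) ^ (-α) * deriv g t else 0

/-- The right Caputo derivative of order `0 < α < 1` with anchor `x`, set to `0` right of `x`. -/
def caputoRight (α x : ℝ) (g : ℝ → ℝ) (y : ℝ) : ℝ :=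
  if y ≤ x then (-1 / Real.Gamma (1 - α)) * ∫ t in y..x, (t - y) ^ (-α) * deriv g t else 0

/-- The `k`-fold iterate `D_{*x}^{kα} f` of the left Caputo derivative of order `α`. -/
def iterCaputoLeft (α x : ℝ) (k : ℕ) (f : ℝ → ℝ) : ℝ → ℝ :=
  (caputoLeft α x)^[k] f

/-- The `k`-fold iterate `D_{x-}^{kα} f` of the right Caputo derivative of order `α`. -/
def iterCaputoRight (α x : ℝ) (k : ℕ) (f : ℝ → ℝ) : ℝ → ℝ :=
  (caputoRight α x)^[k] f

/-- `ω₁(D_x^{kα} f, δ)`: the larger of the moduli of `D_{*x}^{kα} f` over `[x, b]` and of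
`D_{x-}^{kα} f` over `[a, x]`. -/
def caputoModulus (α a b x : ℝ) (k : ℕ) (f : ℝ → ℝ) (δ : ℝ) : ℝ :=
  max (modulusOn (Set.Icc x b) (iterCaputoLeft α x k f) δ)
    (modulusOn (Set.Icc a x) (iterCaputoRight α x k f) δ)

end

/-! Since `neuralOp` is a weighted mean, its error at `x` is the mean of `f (k/n) - f x`, so one
needs a bound on these increments and on the weight of distant nodes.

Increments: the semigroup law I^μ I^ν = I^(μ+ν) for fractional integrals (Fubini and a Beta
integral) gives I^α D^α g = g - g(x). Iterated Caputo derivatives vanish at the anchor, so with ν =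
(N+1)α this iterates to f - f(x) = I^ν g, g = D^ν f. As g(x) = 0, |g(t)| ≤ ω(1 + |t - x|/δ), and
integrating against the kernel yields `abs_sub_le_of_caputoModulus`; points left of `x` are handled
by reflection.

Weights: split the nodes at |nx - k| = T = n^(1-α), that is |k/n - x| = n^(-α). Sums of Φ telescope
and 1 - φ(t) = O(t^(-2m)), so each tail is at most τ = 1/(4m(T-2)^(2m)). The total weight is at
least Φ(1), whose inverse is the leading constant. Two tails would cost 2τ, but when both occur the
total weight is at least 2Φ(1) (`activation_one_mul_sum_far_le`). -/

open MeasureTheory ProbabilityTheory Set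

/-! ### Beta integrals of truncated powers -/

/-- The truncated power `u ↦ u ^ (μ - 1)` for `u > 0`, extended by `0`. -/
noncomputable def truncRpow (μ u : ℝ) : ℝ := if 0 < u then u ^ (μ - 1) else 0

lemma truncRpow_nonneg (μ u : ℝ) : 0 ≤ truncRpow μ u := by
  unfold truncRpow; split_ifs with h
  · exact Real.rpow_nonneg h.le _
  · exact le_rfl

@[fun_prop]
lemma measurable_truncRpow (μ : ℝ) : Measurable (truncRpow μ) :=
  Measurable.ite measurableSet_Ioi (by fun_prop) (by fun_prop)

lemma integrable_betaPDFReal {μ ν : ℝ} (hμ : 0 < μ) (hν : 0 < ν) :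
    Integrable (betaPDFReal μ ν) := by
  refine ⟨(measurable_betaPDFReal μ ν).aestronglyMeasurable, ?_⟩
  rw [hasFiniteIntegral_iff_ofReal]
  · have := lintegral_betaPDF_eq_one hμ hν
    simp only [betaPDF] at this
    rw [this]; simp
  · refine Filter.Eventually.of_forall fun u => ?_
    by_cases h : 0 < u ∧ u < 1
    · exact (betaPDFReal_pos h.1 h.2 hμ hν).le
    · simp [betaPDFReal, h]

lemma integral_betaPDFReal {μ ν : ℝ} (hμ : 0 < μ) (hν : 0 < ν) :
    ∫ u, betaPDFReal μ ν u = 1 := by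
  rw [integral_eq_lintegral_of_nonneg_ae]
  · have := lintegral_betaPDF_eq_one hμ hν
    simp only [betaPDF] at this
    rw [this]; simp
  · refine Filter.Eventually.of_forall fun u => ?_
    by_cases h : 0 < u ∧ u < 1
    · exact (betaPDFReal_pos h.1 h.2 hμ hν).le
    · simp [betaPDFReal, h]
  · exact (measurable_betaPDFReal μ ν).aestronglyMeasurable

/-- Rescaling (t, y) to (0, 1) turns the product into a Beta density, whose integrability and total
mass are known. -/
lemma truncRpow_mul_truncRpow_eq {μ ν : ℝ} (hμ : 0 < μ) (hν : 0 < ν) {t y : ℝ} (h : t < y)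
    (s : ℝ) : truncRpow μ (y - s) * truncRpow ν (s - t) =
      beta ν μ * (y - t) ^ (μ + ν - 2) * betaPDFReal ν μ ((s - t) / (y - t)) := by
  have hL : 0 < y - t := sub_pos.2 h
  have hB := (beta_pos hν hμ).ne'
  by_cases h1 : t < s
  · by_cases h2 : s < y
    · have e1 : 0 < y - s := sub_pos.2 h2
      have e2 : 0 < s - t := sub_pos.2 h1
      have e3 : (s - t) / (y - t) < 1 := by rw [div_lt_one hL]; linarith
      have e4 : 1 - (s - t) / (y - t) = (y - s) / (y - t) := by field_simp; ring
      rw [truncRpow, truncRpow, if_pos e1, if_pos e2, betaPDFReal, if_pos ⟨div_pos e2 hL, e3⟩, e4,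
        Real.div_rpow e2.le hL.le, Real.div_rpow e1.le hL.le,
        show μ + ν - 2 = (ν - 1) + (μ - 1) by ring, Real.rpow_add hL]
      have := (Real.rpow_pos_of_pos hL (ν - 1)).ne'
      have := (Real.rpow_pos_of_pos hL (μ - 1)).ne'
      field_simp
    · have e3 : ¬ ((s - t) / (y - t) < 1) := by rw [div_lt_one hL]; linarith
      simp [truncRpow, betaPDFReal, e3, h2]
  · have e3 : ¬ (0 < (s - t) / (y - t)) := by
      rw [div_pos_iff_of_pos_right hL]; linarith
    simp [truncRpow, betaPDFReal, e3, h1]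

lemma integrable_truncRpow_mul_truncRpow {μ ν : ℝ} (hμ : 0 < μ) (hν : 0 < ν) (t y : ℝ) :
    Integrable fun s => truncRpow μ (y - s) * truncRpow ν (s - t) := by
  rcases lt_or_ge t y with h | h
  · simp_rw [truncRpow_mul_truncRpow_eq hμ hν h]
    exact (((integrable_betaPDFReal hν hμ).comp_div (sub_pos.2 h).ne').comp_sub_right t).const_mul _
  · have : (fun s => truncRpow μ (y - s) * truncRpow ν (s - t)) = fun _ => 0 := by
      funext s
      unfold truncRpow
      split_ifs with h1 h2
      · linarith
      all_goals simp
    rw [this]; exact integrable_zero _ _ _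

lemma integral_truncRpow_mul_truncRpow {μ ν : ℝ} (hμ : 0 < μ) (hν : 0 < ν) (t y : ℝ) :
    ∫ s, truncRpow μ (y - s) * truncRpow ν (s - t) = beta ν μ * truncRpow (μ + ν) (y - t) := by
  rcases lt_or_ge t y with h | h
  · have hL : 0 < y - t := sub_pos.2 h
    simp_rw [truncRpow_mul_truncRpow_eq hμ hν h]
    rw [integral_const_mul, integral_sub_right_eq_self (fun s => betaPDFReal ν μ (s / (y - t))),
      Measure.integral_comp_div, integral_betaPDFReal hν hμ, truncRpow, if_pos hL,
      abs_of_pos hL, smul_eq_mul, mul_one, mul_assoc,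
      show μ + ν - 1 = (μ + ν - 2) + 1 by ring, Real.rpow_add_one hL.ne']
  · have : (fun s => truncRpow μ (y - s) * truncRpow ν (s - t)) = fun _ => 0 := by
      funext s
      unfold truncRpow
      split_ifs with h1 h2
      · linarith
      all_goals simp
    rw [this, truncRpow, if_neg (by linarith)]; simp

/-- Truncation puts both integrals on the whole line, so Fubini needs no triangular domain. Its
hypothesis follows by integrating the norm in `s` first, which leaves a multiple of the norm of the
function in `hi`. -/
lemma integral_truncRpow_semigroup {μ ν : ℝ} (hμ : 0 < μ) (hν : 0 < ν) {y : ℝ} {G : ℝ → ℝ}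
    (hG : AEStronglyMeasurable G)
    (hi : Integrable fun t => truncRpow (μ + ν) (y - t) * G t) :
    ∫ s, truncRpow μ (y - s) * ∫ t, truncRpow ν (s - t) * G t =
      beta ν μ * ∫ t, truncRpow (μ + ν) (y - t) * G t := by
  have hK : Integrable (Function.uncurry fun s t =>
      truncRpow μ (y - s) * truncRpow ν (s - t) * G t) (volume.prod volume) := by
    rw [integrable_prod_iff']
    · refine ⟨Filter.Eventually.of_forall fun t => ?_, ?_⟩
      · exact (integrable_truncRpow_mul_truncRpow hμ hν t y).mul_const (G t)
      · have : (fun t => ∫ s, ‖Function.uncurry (fun s t =>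
            truncRpow μ (y - s) * truncRpow ν (s - t) * G t) (s, t)‖) =
            fun t => beta ν μ * ‖truncRpow (μ + ν) (y - t) * G t‖ := by
          funext t
          simp only [Function.uncurry, norm_mul, Real.norm_of_nonneg (truncRpow_nonneg _ _)]
          rw [integral_mul_const, integral_truncRpow_mul_truncRpow hμ hν]
          ring
        rw [this]
        exact hi.norm.const_mul _
    · have h1 : Measurable fun p : ℝ × ℝ => truncRpow μ (y - p.1) * truncRpow ν (p.1 - p.2) := by
        fun_prop
      exact h1.aestronglyMeasurable.mul hG.comp_snd
  calc _ = ∫ s, ∫ t, truncRpow μ (y - s) * truncRpow ν (s - t) * G t := by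
        simp_rw [mul_assoc, integral_const_mul]
    _ = ∫ t, ∫ s, truncRpow μ (y - s) * truncRpow ν (s - t) * G t := integral_integral_swap hK
    _ = _ := by
        simp_rw [integral_mul_const, integral_truncRpow_mul_truncRpow hμ hν, mul_assoc,
          integral_const_mul]

/-! ### Riemann-Liouville integrals -/

/-- The left Riemann-Liouville fractional integral of order `μ` with anchor `x`. -/
noncomputable def rlIntegral (μ x : ℝ) (g : ℝ → ℝ) (y : ℝ) : ℝ :=
  1 / Real.Gamma μ * ∫ t in x..y, (y - t) ^ (μ - 1) * g t

lemma truncRpow_mul_indicator_eq {μ x b y : ℝ} (hy : y ∈ Icc x b) (g : ℝ → ℝ) :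
    (fun t => truncRpow μ (y - t) * (Ioc x b).indicator g t) =
      (Ioo x y).indicator fun t => (y - t) ^ (μ - 1) * g t := by
  funext t
  by_cases h : t ∈ Ioo x y
  · have h2 : t ∈ Ioc x b := ⟨h.1, h.2.le.trans hy.2⟩
    rw [indicator_of_mem h, indicator_of_mem h2, truncRpow,
      if_pos (sub_pos.2 h.2)]
  · rw [indicator_of_notMem h]
    by_cases h2 : x < t
    · rw [truncRpow, if_neg, zero_mul]
      exact fun h3 => h ⟨h2, sub_pos.1 h3⟩
    · rw [indicator_of_notMem (fun h3 => h2 h3.1), mul_zero]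

lemma rlIntegral_eq_integral {μ x b y : ℝ} (hy : y ∈ Icc x b) (g : ℝ → ℝ) :
    rlIntegral μ x g y =
      1 / Real.Gamma μ * ∫ t, truncRpow μ (y - t) * (Ioc x b).indicator g t := by
  rw [rlIntegral, truncRpow_mul_indicator_eq hy, integral_indicator measurableSet_Ioo,
    intervalIntegral.integral_of_le hy.1, integral_Ioc_eq_integral_Ioo]

lemma rlIntegral_congr {μ x y : ℝ} (hxy : x ≤ y) {g h : ℝ → ℝ} (hgh : EqOn g h (Icc x y)) :
    rlIntegral μ x g y = rlIntegral μ x h y := by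
  unfold rlIntegral
  congr 1
  refine intervalIntegral.integral_congr fun t ht => ?_
  rw [uIcc_of_le hxy] at ht
  simp only [hgh ht]

/-- The semigroup law for fractional integrals. -/
lemma rlIntegral_rlIntegral {μ ν x b y : ℝ} (hμ : 0 < μ) (hν : 0 < ν) (hy : y ∈ Icc x b)
    {g : ℝ → ℝ} (hg : IntervalIntegrable g volume x b)
    (hi : IntervalIntegrable (fun t => (y - t) ^ (μ + ν - 1) * g t) volume x y) :
    rlIntegral μ x (rlIntegral ν x g) y = rlIntegral (μ + ν) x g y := by
  have hxb := hy.1.trans hy.2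
  rw [rlIntegral_eq_integral hy, rlIntegral_eq_integral hy]
  have hG : Integrable ((Ioc x b).indicator g) := by
    rw [integrable_indicator_iff measurableSet_Ioc]
    exact (intervalIntegrable_iff_integrableOn_Ioc_of_le hxb).1 hg
  have hi' : Integrable fun t => truncRpow (μ + ν) (y - t) * (Ioc x b).indicator g t := by
    rw [truncRpow_mul_indicator_eq hy, integrable_indicator_iff measurableSet_Ioo]
    exact (intervalIntegrable_iff_integrableOn_Ioo_of_le hy.1).1 hi
  have key := integral_truncRpow_semigroup hμ hν hG.aestronglyMeasurable hi'
  -- The outer indicator is harmless: for s ≤ x the inner integral is zero, and for s > b ≥ y the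
  -- outer kernel is zero.
  have h1 : ∀ s, truncRpow μ (y - s) * (Ioc x b).indicator (rlIntegral ν x g) s =
      1 / Real.Gamma ν *
        (truncRpow μ (y - s) * ∫ t, truncRpow ν (s - t) * (Ioc x b).indicator g t) := by
    intro s
    by_cases h : s ∈ Ioc x b
    · rw [indicator_of_mem h, rlIntegral_eq_integral (Ioc_subset_Icc_self h)]; ring
    · rw [indicator_of_notMem h]
      by_cases h2 : x < s
      · rw [truncRpow, if_neg]
        · simp
        · intro h3; exact h ⟨h2, by linarith [hy.2]⟩
      · have : ∀ t, truncRpow ν (s - t) * (Ioc x b).indicator g t = 0 := by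
          intro t
          by_cases h4 : x < t
          · rw [truncRpow, if_neg (by linarith), zero_mul]
          · rw [indicator_of_notMem (fun h3 => h4 h3.1), mul_zero]
        simp [this]
  simp_rw [h1]
  rw [integral_const_mul, key, beta, add_comm ν μ]
  have := (Real.Gamma_pos_of_pos hμ).ne'
  have := (Real.Gamma_pos_of_pos hν).ne'
  field_simp

/-! ### Caputo derivatives and the fractional Taylor formula -/

lemma caputoLeft_eq_rlIntegral (α : ℝ) {x y : ℝ} (hxy : x ≤ y) (g : ℝ → ℝ) :
    caputoLeft α x g y = rlIntegral (1 - α) x (deriv g) y := by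
  rw [caputoLeft, if_pos hxy, rlIntegral, show 1 - α - 1 = -α by ring]

lemma caputoLeft_self (α x : ℝ) (g : ℝ → ℝ) : caputoLeft α x g x = 0 := by
  simp [caputoLeft]

/-- Fractional integration inverts the Caputo derivative. -/
lemma rlIntegral_caputoLeft {α x b y : ℝ} (hα0 : 0 < α) (hα1 : α < 1) (hy : y ∈ Icc x b)
    {g : ℝ → ℝ} (hg : AbsolutelyContinuousOnInterval g x b) :
    rlIntegral α x (caputoLeft α x g) y = g y - g x := by
  have hgy : AbsolutelyContinuousOnInterval g x y := hg.mono <| by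
    rw [uIcc_of_le hy.1, uIcc_of_le (hy.1.trans hy.2)]; exact Icc_subset_Icc_right hy.2
  -- I^α I^(1-α) g' = I^1 g', whose kernel is constant: the fundamental theorem of calculus
  -- finishes.
  rw [rlIntegral_congr hy.1 fun t ht => caputoLeft_eq_rlIntegral α ht.1 g,
    rlIntegral_rlIntegral hα0 (by linarith) hy hg.intervalIntegrable_deriv]
  · simp [rlIntegral, hgy.integral_deriv_eq_sub]
  · simpa using hgy.intervalIntegrable_deriv

lemma intervalIntegrable_sub_rpow {c : ℝ} (hc : -1 < c) (x y : ℝ) :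
    IntervalIntegrable (fun t => (y - t) ^ c) volume x y := by
  have := (intervalIntegral.intervalIntegrable_rpow' hc (a := y - x) (b := 0)).comp_sub_left y
  simpa using this

/-- Taylor's formula for iterated Caputo derivatives. -/
lemma sub_eq_rlIntegral_iterCaputoLeft {α x b y : ℝ} (hα0 : 0 < α) (hα1 : α < 1)
    (hy : y ∈ Icc x b) {f : ℝ → ℝ} {N : ℕ}
    (hac : ∀ k ≤ N, AbsolutelyContinuousOnInterval (iterCaputoLeft α x k f) x b)
    (hcont : ∀ k ≤ N + 1, ContinuousOn (iterCaputoLeft α x k f) (Icc x b)) :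
    f y - f x = rlIntegral (((N : ℝ) + 1) * α) x (iterCaputoLeft α x (N + 1) f) y := by
  have hstep : ∀ k ≤ N, ∀ z ∈ Icc x b, rlIntegral α x (iterCaputoLeft α x (k + 1) f) z =
      iterCaputoLeft α x k f z - iterCaputoLeft α x k f x := by
    intro k hk z hz
    rw [← rlIntegral_caputoLeft hα0 hα1 hz (hac k hk)]
    simp only [iterCaputoLeft, Function.iterate_succ_apply']
  induction N with
  | zero => simpa [iterCaputoLeft] using (hstep 0 le_rfl y hy).symm
  | succ N ih =>
    rw [ih (fun k hk => hac k (by omega)) (fun k hk => hcont k (by omega))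
      (fun k hk => hstep k (by omega))]
    -- No boundary term: a Caputo derivative at its anchor integrates over a degenerate interval.
    have h0 : iterCaputoLeft α x (N + 1) f x = 0 := by
      simp only [iterCaputoLeft, Function.iterate_succ_apply', caputoLeft_self]
    have hpos : 0 < ((N : ℝ) + 1) * α := by positivity
    have hc := hcont (N + 2) le_rfl
    have hxb := hy.1.trans hy.2
    rw [rlIntegral_congr hy.1 (h := rlIntegral α x (iterCaputoLeft α x (N + 2) f)),
      rlIntegral_rlIntegral hpos hα0 hy (hc.intervalIntegrable_of_Icc hxb)]
    · push_cast; congr 1; ring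
    · refine (intervalIntegrable_sub_rpow (by linarith) x y).mul_continuousOn ?_
      rw [uIcc_of_le hy.1]
      exact hc.mono (Icc_subset_Icc_right hy.2)
    · intro t ht
      rw [hstep (N + 1) le_rfl t ⟨ht.1, ht.2.trans hy.2⟩, h0, sub_zero]

/-! ### Modulus of continuity and the Taylor remainder -/

lemma modulusOn_nonneg (s : Set ℝ) (g : ℝ → ℝ) (δ : ℝ) : 0 ≤ modulusOn s g δ := by
  refine Real.sSup_nonneg ?_
  rintro r ⟨y, -, z, -, -, rfl⟩
  exact abs_nonneg _

/-- Compactness is needed: on an unbounded set of differences `sSup` defaults to 0. -/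
lemma abs_sub_le_modulusOn {s : Set ℝ} (hs : IsCompact s) {g : ℝ → ℝ} (hg : ContinuousOn g s)
    {δ y z : ℝ} (hy : y ∈ s) (hz : z ∈ s) (hyz : |y - z| ≤ δ) :
    |g y - g z| ≤ modulusOn s g δ := by
  obtain ⟨C, hC⟩ := hs.exists_bound_of_continuousOn hg
  refine le_csSup ⟨C + C, ?_⟩ ⟨y, hy, z, hz, hyz, rfl⟩
  rintro r ⟨u, hu, v, hv, -, rfl⟩
  exact (abs_sub _ _).trans (add_le_add (hC u hu) (hC v hv))

/-- Walk from `x` to `t` in ⌊(t - x)/δ⌋ steps of length δ and one shorter step; each costs at most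
one modulus. -/
lemma abs_sub_le_modulusOn_mul {x b : ℝ} {g : ℝ → ℝ} (hg : ContinuousOn g (Icc x b))
    {δ t : ℝ} (hδ : 0 < δ) (ht : t ∈ Icc x b) :
    |g t - g x| ≤ modulusOn (Icc x b) g δ * (1 + (t - x) / δ) := by
  have hω := modulusOn_nonneg (Icc x b) g δ
  have step : ∀ n : ℕ, x + n * δ ≤ b →
      |g (x + n * δ) - g x| ≤ n * modulusOn (Icc x b) g δ := by
    intro n
    induction n with
    | zero => simp
    | succ n ih =>
      intro h
      push_cast at h ⊢
      have h0 : 0 ≤ (n : ℝ) * δ := by positivity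
      have h1 := ih (by linarith)
      have h2 := abs_sub_le_modulusOn isCompact_Icc hg (δ := δ)
        (y := x + (n + 1) * δ) (z := x + n * δ) ⟨by linarith, h⟩ ⟨by linarith, by linarith⟩
        (by rw [abs_of_nonneg] <;> linarith)
      have h3 := abs_sub_le (g (x + (n + 1) * δ)) (g (x + n * δ)) (g x)
      linarith
  have hq : 0 ≤ (t - x) / δ := div_nonneg (sub_nonneg.2 ht.1) hδ.le
  set n := ⌊(t - x) / δ⌋₊
  have h1 : (n : ℝ) ≤ (t - x) / δ := Nat.floor_le hq
  have h2 : (t - x) / δ < n + 1 := Nat.lt_floor_add_one _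
  have h1' := (le_div_iff₀ hδ).1 h1
  have h2' := (div_lt_iff₀ hδ).1 h2
  have h0 : 0 ≤ (n : ℝ) * δ := by positivity
  have h3 := step n (by linarith [ht.2])
  have h4 := abs_sub_le_modulusOn isCompact_Icc hg (δ := δ) (z := x + n * δ) ht
    ⟨by linarith, by linarith [ht.2]⟩ (by rw [abs_of_nonneg] <;> linarith)
  have h5 := abs_sub_le (g t) (g (x + n * δ)) (g x)
  have h6 := mul_le_mul_of_nonneg_right h1 hω
  linarith

/-- Writing t - x = (y - x) - (y - t) reduces the integrand to two pure powers of y - t. -/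
lemma integral_sub_rpow_mul_one_add {ν δ x y : ℝ} (hν : 0 < ν) (hδ : 0 < δ) (hxy : x ≤ y) :
    IntervalIntegrable (fun t => (y - t) ^ (ν - 1) * (1 + (t - x) / δ)) volume x y ∧
    ∫ t in x..y, (y - t) ^ (ν - 1) * (1 + (t - x) / δ) =
      1 / ν * ((y - x) ^ ν + (y - x) ^ (ν + 1) / (δ * (ν + 1))) := by
  have i1 := intervalIntegrable_sub_rpow (show -1 < ν - 1 by linarith) x y
  have i2 := intervalIntegrable_sub_rpow (show -1 < ν by linarith) x y
  have e : (fun t => (y - t) ^ (ν - 1) * (1 + (t - x) / δ)) =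
      fun t => (1 + (y - x) / δ) * (y - t) ^ (ν - 1) - 1 / δ * (y - t) ^ ν := by
    funext t
    rcases eq_or_ne (y - t) 0 with h | h
    · have : t = y := by linarith
      subst this
      simp [Real.zero_rpow hν.ne']; ring
    · rw [Real.rpow_sub_one h]; field_simp; ring
  have int : ∀ c : ℝ, -1 < c → ∫ t in x..y, (y - t) ^ c = (y - x) ^ (c + 1) / (c + 1) := by
    intro c hc
    rw [intervalIntegral.integral_comp_sub_left (fun u => u ^ c), integral_rpow (Or.inl hc),
      sub_self, Real.zero_rpow (by linarith), sub_zero]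
  rw [e]
  refine ⟨(i1.const_mul _).sub (i2.const_mul _), ?_⟩
  rw [intervalIntegral.integral_sub (i1.const_mul _) (i2.const_mul _),
    intervalIntegral.integral_const_mul, intervalIntegral.integral_const_mul,
    int _ (by linarith), int _ (by linarith), sub_add_cancel]
  rcases eq_or_lt_of_le hxy with rfl | h
  · simp [Real.zero_rpow hν.ne', Real.zero_rpow (show ν + 1 ≠ 0 by linarith)]
  · rw [Real.rpow_add_one (sub_pos.2 h).ne']
    field_simp
    ring

lemma abs_rlIntegral_le {ν x b y δ : ℝ} (hν : 0 < ν) (hδ : 0 < δ) (hy : y ∈ Icc x b)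
    {g : ℝ → ℝ} (hg : ContinuousOn g (Icc x b)) (hgx : g x = 0) :
    |rlIntegral ν x g y| ≤ modulusOn (Icc x b) g δ / Real.Gamma (ν + 1) *
      ((y - x) ^ ν + (y - x) ^ (ν + 1) / (δ * (ν + 1))) := by
  obtain ⟨hint, heq⟩ := integral_sub_rpow_mul_one_add hν hδ hy.1
  have hΓ := Real.Gamma_pos_of_pos hν
  have hbound := intervalIntegral.norm_integral_le_of_norm_le hy.1
    (f := fun t => (y - t) ^ (ν - 1) * g t)
    (g := fun t => modulusOn (Icc x b) g δ * ((y - t) ^ (ν - 1) * (1 + (t - x) / δ)))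
    (μ := volume) (Filter.Eventually.of_forall fun t ht => by
      have h1 := abs_sub_le_modulusOn_mul hg hδ (⟨ht.1.le, ht.2.trans hy.2⟩ : t ∈ Icc x b)
      rw [hgx, sub_zero] at h1
      have h2 : 0 ≤ (y - t) ^ (ν - 1) := Real.rpow_nonneg (by linarith [ht.2]) _
      rw [norm_mul, Real.norm_of_nonneg h2, Real.norm_eq_abs]
      calc _ ≤ (y - t) ^ (ν - 1) * _ := mul_le_mul_of_nonneg_left h1 h2
        _ = _ := by ring) (hint.const_mul _)
  rw [intervalIntegral.integral_const_mul, heq, Real.norm_eq_abs] at hbound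
  rw [rlIntegral, abs_mul, abs_of_pos (by positivity), Real.Gamma_add_one hν.ne']
  calc _ ≤ 1 / Real.Gamma ν * _ := mul_le_mul_of_nonneg_left hbound (by positivity)
    _ = _ := by field_simp

lemma abs_sub_le_of_iterCaputoLeft {α x b y δ : ℝ} (hα0 : 0 < α) (hα1 : α < 1) (hδ : 0 < δ)
    (hy : y ∈ Icc x b) {f : ℝ → ℝ} {N : ℕ}
    (hac : ∀ k ≤ N, AbsolutelyContinuousOnInterval (iterCaputoLeft α x k f) x b)
    (hcont : ∀ k ≤ N + 1, ContinuousOn (iterCaputoLeft α x k f) (Icc x b)) :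
    |f y - f x| ≤ modulusOn (Icc x b) (iterCaputoLeft α x (N + 1) f) δ /
        Real.Gamma (((N : ℝ) + 1) * α + 1) * (|y - x| ^ (((N : ℝ) + 1) * α) +
          |y - x| ^ (((N : ℝ) + 1) * α + 1) / (δ * (((N : ℝ) + 1) * α + 1))) := by
  rw [sub_eq_rlIntegral_iterCaputoLeft hα0 hα1 hy hac hcont, abs_of_nonneg (sub_nonneg.2 hy.1)]
  refine abs_rlIntegral_le (by positivity) hδ hy (hcont _ le_rfl) ?_
  simp only [iterCaputoLeft, Function.iterate_succ_apply', caputoLeft_self]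

/-! ### Reflection to the right-sided derivatives -/

lemma AbsolutelyContinuousOnInterval.comp_neg {f : ℝ → ℝ} {a b : ℝ}
    (hf : AbsolutelyContinuousOnInterval f a b) :
    AbsolutelyContinuousOnInterval (fun t => f (-t)) (-b) (-a) := by
  rw [absolutelyContinuousOnInterval_iff] at hf ⊢
  intro ε hε
  obtain ⟨δ, hδ, H⟩ := hf ε hε
  refine ⟨δ, hδ, fun E hE hlen => ?_⟩
  refine H (E.1, fun i => (-(E.2 i).1, -(E.2 i).2)) ⟨fun i hi => ?_, ?_⟩ ?_
  · have := hE.1 i hi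
    simp only [uIcc, mem_Icc, inf_le_iff, le_sup_iff] at this ⊢
    constructor
    · constructor <;> grind
    · constructor <;> grind
  · intro i hi j hj hij
    have h := hE.2 hi hj hij
    -- Reflection moves the open end of a half-open interval, so disjointness is compared through
    -- endpoints.
    simp only [Function.onFun, uIoc, Ioc_disjoint_Ioc] at h ⊢
    simp only [max_neg_neg, min_neg_neg] at h ⊢
    linarith
  · simpa using hlen

/-- The sign in the right derivative cancels that of the chain rule. The value 0 beyond the anchor
makes this an identity of functions on all of ℝ, hence iterable. -/
lemma caputoLeft_comp_neg (α x : ℝ) (g : ℝ → ℝ) :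
    caputoLeft α (-x) (fun t => g (-t)) = fun y => caputoRight α x g (-y) := by
  funext y
  by_cases h : -x ≤ y
  · rw [caputoLeft, caputoRight, if_pos h, if_pos (by linarith), neg_div, neg_mul, ← mul_neg,
      ← intervalIntegral.integral_neg]
    have e := intervalIntegral.integral_comp_neg (a := -x) (b := y)
      (fun t => -((t - -y) ^ (-α) * deriv g t))
    rw [neg_neg] at e
    rw [← e]
    congr 1
    refine intervalIntegral.integral_congr fun t _ => ?_
    simp only [deriv_comp_neg]
    rw [show -t - -y = y - t by ring]; ring
  · rw [caputoLeft, caputoRight, if_neg h, if_neg (by linarith)]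

lemma iterCaputoLeft_comp_neg (α x : ℝ) (k : ℕ) (f : ℝ → ℝ) :
    iterCaputoLeft α (-x) k (fun t => f (-t)) = fun y => iterCaputoRight α x k f (-y) := by
  induction k with
  | zero => rfl
  | succ k ih =>
    simp only [iterCaputoLeft, iterCaputoRight, Function.iterate_succ_apply'] at ih ⊢
    rw [ih, caputoLeft_comp_neg]

lemma modulusOn_comp_neg (a x : ℝ) (g : ℝ → ℝ) (δ : ℝ) :
    modulusOn (Icc (-x) (-a)) (fun y => g (-y)) δ = modulusOn (Icc a x) g δ := by
  unfold modulusOn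
  congr 1
  ext r
  constructor
  · rintro ⟨y, hy, z, hz, h, rfl⟩
    exact ⟨-y, ⟨by linarith [hy.2], by linarith [hy.1]⟩, -z, ⟨by linarith [hz.2],
      by linarith [hz.1]⟩, by rwa [neg_sub_neg, abs_sub_comm], rfl⟩
  · rintro ⟨y, hy, z, hz, h, rfl⟩
    exact ⟨-y, ⟨by linarith [hy.2], by linarith [hy.1]⟩, -z, ⟨by linarith [hz.2],
      by linarith [hz.1]⟩, by rwa [neg_sub_neg, abs_sub_comm], by simp⟩

lemma abs_sub_le_of_iterCaputoRight {α a x y δ : ℝ} (hα0 : 0 < α) (hα1 : α < 1) (hδ : 0 < δ)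
    (hy : y ∈ Icc a x) {f : ℝ → ℝ} {N : ℕ}
    (hac : ∀ k ≤ N, AbsolutelyContinuousOnInterval (iterCaputoRight α x k f) a x)
    (hcont : ∀ k ≤ N + 1, ContinuousOn (iterCaputoRight α x k f) (Icc a x)) :
    |f y - f x| ≤ modulusOn (Icc a x) (iterCaputoRight α x (N + 1) f) δ /
        Real.Gamma (((N : ℝ) + 1) * α + 1) * (|y - x| ^ (((N : ℝ) + 1) * α) +
          |y - x| ^ (((N : ℝ) + 1) * α + 1) / (δ * (((N : ℝ) + 1) * α + 1))) := by
  have hy' : -y ∈ Icc (-x) (-a) := ⟨by linarith [hy.2], by linarith [hy.1]⟩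
  have h := abs_sub_le_of_iterCaputoLeft hα0 hα1 hδ hy' (f := fun t => f (-t)) (N := N)
    (fun k hk => by
      rw [iterCaputoLeft_comp_neg]
      exact (hac k hk).comp_neg)
    (fun k hk => by
      rw [iterCaputoLeft_comp_neg]
      exact (hcont k hk).comp continuousOn_neg
        fun t ht => ⟨by linarith [ht.2], by linarith [ht.1]⟩)
  rw [iterCaputoLeft_comp_neg, modulusOn_comp_neg] at h
  simpa only [neg_neg, neg_sub_neg, abs_sub_comm x y] using h

lemma caputoModulus_nonneg (α a b x : ℝ) (k : ℕ) (f : ℝ → ℝ) (δ : ℝ) :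
    0 ≤ caputoModulus α a b x k f δ :=
  (modulusOn_nonneg _ _ _).trans (le_max_left _ _)

lemma abs_sub_le_of_caputoModulus {α a b x y δ : ℝ} (hα0 : 0 < α) (hα1 : α < 1) (hδ : 0 < δ)
    (hx : x ∈ Icc a b) (hy : y ∈ Icc a b) {f : ℝ → ℝ} {N : ℕ}
    (hfac : AbsolutelyContinuousOnInterval f a b)
    (hLac : ∀ k : ℕ, 1 ≤ k → k ≤ N → AbsolutelyContinuousOnInterval (iterCaputoLeft α x k f) x b)
    (hRac : ∀ k : ℕ, 1 ≤ k → k ≤ N → AbsolutelyContinuousOnInterval (iterCaputoRight α x k f) a x)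
    (hLcont : ∀ k : ℕ, k ≤ N + 1 → ContinuousOn (iterCaputoLeft α x k f) (Icc x b))
    (hRcont : ∀ k : ℕ, k ≤ N + 1 → ContinuousOn (iterCaputoRight α x k f) (Icc a x)) :
    |f y - f x| ≤ caputoModulus α a b x (N + 1) f δ /
        Real.Gamma (((N : ℝ) + 1) * α + 1) * (|y - x| ^ (((N : ℝ) + 1) * α) +
          |y - x| ^ (((N : ℝ) + 1) * α + 1) / (δ * (((N : ℝ) + 1) * α + 1))) := by
  have hΓ : 0 < Real.Gamma (((N : ℝ) + 1) * α + 1) := Real.Gamma_pos_of_pos (by positivity)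
  have hab := hx.1.trans hx.2
  rcases le_total x y with hxy | hxy
  · refine (abs_sub_le_of_iterCaputoLeft hα0 hα1 hδ ⟨hxy, hy.2⟩ (fun k hk => ?_)
      (fun k hk => hLcont k hk)).trans ?_
    · rcases Nat.eq_zero_or_pos k with rfl | h
      · refine hfac.mono ?_
        rw [uIcc_of_le hx.2, uIcc_of_le hab]
        exact Icc_subset_Icc_left hx.1
      · exact hLac k h hk
    · gcongr
      exact le_max_left _ _
  · refine (abs_sub_le_of_iterCaputoRight hα0 hα1 hδ ⟨hy.1, hxy⟩ (fun k hk => ?_)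
      (fun k hk => hRcont k hk)).trans ?_
    · rcases Nat.eq_zero_or_pos k with rfl | h
      · refine hfac.mono ?_
        rw [uIcc_of_le hx.1, uIcc_of_le hab]
        exact Icc_subset_Icc_right hx.2
      · exact hRac k h hk
    · gcongr
      exact le_max_right _ _

/-! ### The sigmoid φ and the activation Φ -/

lemma one_add_pow_two_mul_pos (m : ℕ) (t : ℝ) : 0 < 1 + t ^ (2 * m) := by
  have := (even_two_mul m).pow_nonneg t
  linarith

lemma sigmoidGen_neg (m : ℕ) (t : ℝ) : sigmoidGen m (-t) = -sigmoidGen m t := by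
  rw [sigmoidGen, sigmoidGen, (even_two_mul m).neg_pow, neg_div]

lemma activation_neg (m : ℕ) (t : ℝ) : activation m (-t) = activation m t := by
  rw [activation, activation, show -t + 1 = -(t - 1) by ring, show -t - 1 = -(t + 1) by ring,
    sigmoidGen_neg, sigmoidGen_neg]
  ring

lemma hasDerivAt_sigmoidGen {m : ℕ} (hm : 1 ≤ m) (t : ℝ) :
    HasDerivAt (sigmoidGen m) ((1 + t ^ (2 * m)) ^ (-(1 / (2 * (m : ℝ)) + 1))) t := by
  have hpos := one_add_pow_two_mul_pos m t
  have hm' : (m : ℝ) ≠ 0 := by positivity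
  have h1 : HasDerivAt (fun t : ℝ => 1 + t ^ (2 * m)) (((2 * m : ℕ) : ℝ) * t ^ (2 * m - 1)) t := by
    simpa using (hasDerivAt_pow (2 * m) t).const_add 1
  have h2 := h1.rpow_const (p := 1 / (2 * (m : ℝ))) (Or.inl hpos.ne')
  have h3 := (hasDerivAt_id t).div h2 (Real.rpow_pos_of_pos hpos _).ne'
  refine h3.congr_deriv ?_
  have hp := Real.rpow_pos_of_pos hpos (1 / (2 * (m : ℝ)))
  rw [Real.rpow_sub_one hpos.ne', Real.rpow_neg hpos.le, Real.rpow_add_one hpos.ne']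
  have h4 : t ^ (2 * m) = t ^ (2 * m - 1) * t := by
    rw [← pow_succ]; congr 1; omega
  simp only [id]
  push_cast
  generalize (1 + t ^ (2 * m)) ^ (1 / (2 * (m : ℝ))) = P at *
  have : P ≠ 0 := hp.ne'
  have hpos' := hpos.ne'
  rw [h4, mul_comm] at hpos' ⊢
  generalize t ^ (2 * m - 1) = q at *
  field_simp
  ring

lemma sigmoidGen_monotone {m : ℕ} (hm : 1 ≤ m) : Monotone (sigmoidGen m) :=
  monotone_of_deriv_nonneg (fun t => (hasDerivAt_sigmoidGen hm t).differentiableAt) fun t => by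
    rw [(hasDerivAt_sigmoidGen hm t).deriv]
    exact Real.rpow_nonneg (one_add_pow_two_mul_pos m t).le _

lemma activation_nonneg {m : ℕ} (hm : 1 ≤ m) (t : ℝ) : 0 ≤ activation m t := by
  have := sigmoidGen_monotone hm (show t - 1 ≤ t + 1 by linarith)
  rw [activation]; linarith

/-- φ' is a decreasing function of |t|, and |t - 1| ≤ |t + 1| for t ≥ 0. -/
lemma activation_antitoneOn {m : ℕ} (hm : 1 ≤ m) : AntitoneOn (activation m) (Ici 0) := by
  have hd : ∀ t, HasDerivAt (activation m)
      (1 / 4 * ((1 + (t + 1) ^ (2 * m)) ^ (-(1 / (2 * (m : ℝ)) + 1)) -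
        (1 + (t - 1) ^ (2 * m)) ^ (-(1 / (2 * (m : ℝ)) + 1)))) t := fun t =>
    (((hasDerivAt_sigmoidGen hm (t + 1)).comp_add_const t 1).sub
      ((hasDerivAt_sigmoidGen hm (t - 1)).comp_sub_const t 1)).const_mul (1 / 4)
  refine antitoneOn_of_deriv_nonpos (convex_Ici 0)
    (fun t _ => (hd t).continuousAt.continuousWithinAt)
    (fun t _ => (hd t).differentiableAt.differentiableWithinAt) fun t ht => ?_
  rw [interior_Ici, mem_Ioi] at ht
  rw [(hd t).deriv]
  have h1 : (t - 1) ^ (2 * m) ≤ (t + 1) ^ (2 * m) := by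
    rw [pow_mul, pow_mul]
    exact pow_le_pow_left₀ (sq_nonneg _) (by nlinarith) _
  have h2 := Real.rpow_le_rpow_of_nonpos (z := -(1 / (2 * (m : ℝ)) + 1))
    (one_add_pow_two_mul_pos m (t - 1)) (add_le_add_right h1 1)
    (by have : 0 ≤ 1 / (2 * (m : ℝ)) := by positivity
        linarith)
  linarith

lemma activation_one (m : ℕ) :
    activation m 1 = 1 / (2 * (1 + 4 ^ m : ℝ) ^ (1 / (2 * (m : ℝ)))) := by
  rw [activation, sigmoidGen, sigmoidGen, sub_self, zero_div, sub_zero, one_add_one_eq_two, pow_mul]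
  norm_num
  ring

lemma activation_one_le {m : ℕ} {t : ℝ} (hm : 1 ≤ m) (ht : |t| ≤ 1) :
    activation m 1 ≤ activation m t := by
  have h := activation_antitoneOn hm (abs_nonneg t) (zero_le_one : (0 : ℝ) ≤ 1) ht
  rcases abs_choice t with h' | h' <;> rw [h'] at h
  · exact h
  · rwa [activation_neg] at h

lemma abs_eq_pow_rpow {m : ℕ} (hm : 1 ≤ m) (t : ℝ) :
    |t| = (t ^ (2 * m)) ^ (1 / (2 * (m : ℝ))) := by
  rw [← (even_two_mul m).pow_abs, one_div,
    show (2 * (m : ℝ)) = ((2 * m : ℕ) : ℝ) by push_cast; ring,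
    Real.pow_rpow_inv_natCast (abs_nonneg t) (by omega)]

lemma sigmoidGen_le_one {m : ℕ} (hm : 1 ≤ m) (t : ℝ) : sigmoidGen m t ≤ 1 := by
  have hpos := one_add_pow_two_mul_pos m t
  rw [sigmoidGen, div_le_one (Real.rpow_pos_of_pos hpos _)]
  refine (le_abs_self t).trans ?_
  rw [abs_eq_pow_rpow hm]
  exact Real.rpow_le_rpow ((even_two_mul m).pow_nonneg t) (by linarith) (by positivity)

/-- φ(t) = (1 + t^(-2m))^(-1/(2m)); apply Bernoulli with exponent at most 1, then 1/(1 + u) ≥ 1 - u.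
-/
lemma one_sub_sigmoidGen_le {m : ℕ} (hm : 1 ≤ m) {t : ℝ} (ht : 0 < t) :
    1 - sigmoidGen m t ≤ 1 / (2 * m * t ^ (2 * m)) := by
  have hm' : (1 : ℝ) ≤ m := by exact_mod_cast hm
  have hp0 : 0 < 1 / (2 * (m : ℝ)) := by positivity
  have hp1 : 1 / (2 * (m : ℝ)) ≤ 1 := by rw [div_le_one] <;> linarith
  have hpow : 0 < t ^ (2 * m) := by positivity
  have e : (1 + t ^ (2 * m)) ^ (1 / (2 * (m : ℝ))) =
      t * (1 + 1 / t ^ (2 * m)) ^ (1 / (2 * (m : ℝ))) := by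
    have h := abs_eq_pow_rpow hm t
    rw [abs_of_pos ht] at h
    nth_rewrite 2 [h]
    rw [← Real.mul_rpow hpow.le (by positivity)]
    congr 1
    field_simp
    ring
  have hs : 0 < 1 / t ^ (2 * m) := by positivity
  have hb := rpow_one_add_le_one_add_mul_self (s := 1 / t ^ (2 * m)) (by linarith) hp0.le hp1
  have h1 : 1 / (2 * m * t ^ (2 * m)) = 1 / (2 * (m : ℝ)) * (1 / t ^ (2 * m)) := by
    rw [div_mul_div_comm, one_mul]
  rw [sigmoidGen, e, h1, ← div_div, div_self ht.ne']
  have hq : 0 < (1 + 1 / t ^ (2 * m)) ^ (1 / (2 * (m : ℝ))) := by positivity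
  set u := 1 / (2 * (m : ℝ)) * (1 / t ^ (2 * m))
  have hu : 0 < u := by positivity
  have h2 : 1 / (1 + u) ≤ 1 / (1 + 1 / t ^ (2 * m)) ^ (1 / (2 * (m : ℝ))) :=
    one_div_le_one_div_of_le hq hb
  have h3 : 1 - u ≤ 1 / (1 + u) := by
    rw [le_div_iff₀ (by linarith)]; nlinarith
  linarith

/-! ### Tails and lower bounds for sums of Φ -/

lemma sum_range_activation (m : ℕ) (t : ℝ) (n : ℕ) :
    ∑ j ∈ Finset.range n, activation m (t + j) =
      1 / 4 * ((sigmoidGen m (t + n) + sigmoidGen m (t + n - 1)) -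
        (sigmoidGen m t + sigmoidGen m (t - 1))) := by
  induction n with
  | zero => simp
  | succ n ih =>
    rw [Finset.sum_range_succ, ih, activation]
    push_cast
    rw [show t + (n + 1 : ℝ) - 1 = t + n by ring, show t + (n + 1 : ℝ) = t + n + 1 by ring]
    ring

/-- After telescoping, φ ≤ 1 at the far end and φ(t) ≥ φ(t - 1) at the near end leave (1 - φ(t -
1))/2. -/
lemma sum_range_activation_le {m : ℕ} (hm : 1 ≤ m) {t : ℝ} (ht : 1 < t) (n : ℕ) :
    ∑ j ∈ Finset.range n, activation m (t + j) ≤ 1 / (4 * m * (t - 1) ^ (2 * m)) := by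
  have hm' : (1 : ℝ) ≤ m := by exact_mod_cast hm
  rw [sum_range_activation]
  have h1 := sigmoidGen_le_one hm (t + n)
  have h2 := sigmoidGen_le_one hm (t + n - 1)
  have h3 := one_sub_sigmoidGen_le hm (show 0 < t - 1 by linarith)
  have h4 := sigmoidGen_monotone hm (show t - 1 ≤ t by linarith)
  have h5 : 1 / (4 * m * (t - 1) ^ (2 * m)) = 1 / 2 * (1 / (2 * m * (t - 1) ^ (2 * m))) := by
    rw [div_mul_div_comm]; ring
  linarith

lemma sum_activation_le_of_add_lt {m : ℕ} (hm : 1 ≤ m) {z T : ℝ} (hT : 2 < T) {S : Finset ℤ}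
    (hS : ∀ k ∈ S, z + T < k) :
    ∑ k ∈ S, activation m (z - k) ≤ 1 / (4 * m * (T - 2) ^ (2 * m)) := by
  have hm' : (1 : ℝ) ≤ m := by exact_mod_cast hm
  set k₀ : ℤ := ⌊z + T⌋ + 1
  have hk₀ : z + T < k₀ := by simp [k₀]
  have hle : ∀ k ∈ S, k₀ ≤ k := fun k hk => Int.add_one_le_iff.2 (Int.floor_lt.2 (hS k hk))
  have hinj : Set.InjOn (fun k : ℤ => (k - k₀).toNat) S := by
    intro k hk l hl h
    have := hle k hk
    have := hle l hl
    simp only at h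
    omega
  obtain ⟨n, hn⟩ := Finset.exists_nat_subset_range (S.image fun k : ℤ => (k - k₀).toNat)
  calc ∑ k ∈ S, activation m (z - k)
      = ∑ j ∈ S.image (fun k : ℤ => (k - k₀).toNat), activation m (k₀ - z + j) := by
        rw [Finset.sum_image hinj]
        refine Finset.sum_congr rfl fun k hk => ?_
        have h1 : (((k - k₀).toNat : ℤ) : ℝ) = ((k - k₀ : ℤ) : ℝ) := by
          rw [Int.toNat_of_nonneg (sub_nonneg.2 (hle k hk))]
        rw [Int.cast_natCast] at h1
        rw [h1, ← activation_neg]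
        push_cast
        congr 1; ring
    _ ≤ ∑ j ∈ Finset.range n, activation m (k₀ - z + j) :=
        Finset.sum_le_sum_of_subset_of_nonneg hn fun _ _ _ => activation_nonneg hm _
    _ ≤ 1 / (4 * m * (k₀ - z - 1) ^ (2 * m)) := sum_range_activation_le hm (by linarith) n
    _ ≤ _ := by
        have h1 : 0 < T - 2 := by linarith
        -- In fact k₀ - z - 1 > T - 1; the weaker T - 2 is the form of the final bound.
        have h2 : T - 2 ≤ k₀ - z - 1 := by linarith
        gcongr

lemma sum_activation_le_of_lt_sub {m : ℕ} (hm : 1 ≤ m) {z T : ℝ} (hT : 2 < T) {S : Finset ℤ}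
    (hS : ∀ k ∈ S, (k : ℝ) < z - T) :
    ∑ k ∈ S, activation m (z - k) ≤ 1 / (4 * m * (T - 2) ^ (2 * m)) := by
  have h := sum_activation_le_of_add_lt hm (z := -z) hT (S := S.image Neg.neg) (by
    intro k hk
    obtain ⟨l, hl, rfl⟩ := Finset.mem_image.1 hk
    have := hS l hl
    push_cast; linarith)
  rw [Finset.sum_image neg_injective.injOn] at h
  refine le_trans (le_of_eq (Finset.sum_congr rfl fun k _ => ?_)) h
  rw [← activation_neg]
  push_cast
  congr 1; ring

/-- ⌊z⌋ works unless it lies below `A`; then z < A < z + 1 and `A` itself works. -/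
lemma exists_int_abs_sub_le_one {A B : ℤ} {z : ℝ} (hAB : A ≤ B) (hA : (A : ℝ) < z + 1)
    (hB : z - 1 < B) : ∃ k ∈ Finset.Icc A B, |z - k| ≤ 1 := by
  have h1 := Int.floor_le z
  have h2 := Int.lt_floor_add_one z
  rcases le_or_gt A ⌊z⌋ with h | h
  · refine ⟨⌊z⌋, Finset.mem_Icc.2 ⟨h, ?_⟩, by rw [abs_le]; constructor <;> linarith⟩
    have : ((⌊z⌋ : ℤ) : ℝ) < ((B + 1 : ℤ) : ℝ) := by push_cast; linarith
    exact Int.lt_add_one_iff.1 (by exact_mod_cast this)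
  · refine ⟨A, Finset.mem_Icc.2 ⟨le_rfl, hAB⟩, ?_⟩
    have := Int.floor_lt.1 h
    rw [abs_le]; constructor <;> linarith

lemma activation_one_le_sum {m : ℕ} (hm : 1 ≤ m) {A B : ℤ} {z : ℝ} (hAB : A ≤ B)
    (hA : (A : ℝ) < z + 1) (hB : z - 1 < B) :
    activation m 1 ≤ ∑ k ∈ Finset.Icc A B, activation m (z - k) := by
  obtain ⟨k, hk, h⟩ := exists_int_abs_sub_le_one hAB hA hB
  exact (activation_one_le hm h).trans
    (Finset.single_le_sum (f := fun k : ℤ => activation m (z - k))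
      (fun _ _ => activation_nonneg hm _) hk)

lemma two_mul_activation_one_le_sum {m : ℕ} (hm : 1 ≤ m) {A B : ℤ} {z : ℝ}
    (hA : (A : ℝ) ≤ z) (hB : z + 1 ≤ B) :
    2 * activation m 1 ≤ ∑ k ∈ Finset.Icc A B, activation m (z - k) := by
  have h1 := Int.floor_le z
  have h2 := Int.lt_floor_add_one z
  have h3 : A ≤ ⌊z⌋ := Int.le_floor.2 hA
  have h4 : ⌊z⌋ + 1 ≤ B := by
    have : ((⌊z⌋ + 1 : ℤ) : ℝ) ≤ B := by push_cast; linarith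
    exact_mod_cast this
  have hsub : ({⌊z⌋, ⌊z⌋ + 1} : Finset ℤ) ⊆ Finset.Icc A B := by
    intro k hk
    simp only [Finset.mem_insert, Finset.mem_singleton] at hk
    rw [Finset.mem_Icc]; omega
  refine le_trans ?_ (Finset.sum_le_sum_of_subset_of_nonneg hsub
    fun _ _ _ => activation_nonneg hm _)
  rw [Finset.sum_pair (by omega)]
  have h5 : activation m 1 ≤ activation m (z - ⌊z⌋) :=
    activation_one_le hm (by rw [abs_le]; constructor <;> linarith)
  have h6 : activation m 1 ≤ activation m (z - (⌊z⌋ + 1 : ℤ)) :=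
    activation_one_le hm (by push_cast; rw [abs_le]; constructor <;> linarith)
  linarith

/-- The weight far from `z` is controlled relative to the total weight. If both tails are present,
the total weight is at least `2 Φ(1)`. -/
lemma activation_one_mul_sum_far_le {m : ℕ} (hm : 1 ≤ m) {A B : ℤ} {z T : ℝ} (hT : 2 < T)
    (hAB : A ≤ B) (hA : (A : ℝ) < z + 1) (hB : z - 1 < B) :
    activation m 1 * ∑ k ∈ Finset.Icc A B with (T < |z - ((k : ℤ) : ℝ)|), activation m (z - k) ≤
      (∑ k ∈ Finset.Icc A B, activation m (z - k)) * (1 / (4 * m * (T - 2) ^ (2 * m))) := by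
  set τ := 1 / (4 * (m : ℝ) * (T - 2) ^ (2 * m)) with hτ
  have hτ0 : 0 ≤ τ := by have : 0 < T - 2 := by linarith
                         positivity
  set V := ∑ k ∈ Finset.Icc A B, activation m (z - k)
  set R := (Finset.Icc A B).filter fun k : ℤ => z + T < k
  set L := (Finset.Icc A B).filter fun k : ℤ => (k : ℝ) < z - T
  have hR : ∑ k ∈ R, activation m (z - k) ≤ τ :=
    sum_activation_le_of_add_lt hm hT fun k hk => (Finset.mem_filter.1 hk).2
  have hL : ∑ k ∈ L, activation m (z - k) ≤ τ :=
    sum_activation_le_of_lt_sub hm hT fun k hk => (Finset.mem_filter.1 hk).2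
  have hdisj : Disjoint R L := by
    rw [Finset.disjoint_left]
    intro k hk hk'
    have h1 := (Finset.mem_filter.1 hk).2
    have h2 := (Finset.mem_filter.1 hk').2
    linarith
  have hfar : (Finset.Icc A B).filter (fun k : ℤ => T < |z - (k : ℝ)|) = R ∪ L := by
    ext k
    simp only [R, L, Finset.mem_union, Finset.mem_filter, lt_abs]
    constructor
    · rintro ⟨h, h' | h'⟩
      · exact Or.inr ⟨h, by linarith⟩
      · exact Or.inl ⟨h, by linarith⟩
    · rintro (⟨h, h'⟩ | ⟨h, h'⟩)
      · exact ⟨h, Or.inr (by linarith)⟩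
      · exact ⟨h, Or.inl (by linarith)⟩
  have hΦ := activation_nonneg hm 1
  have hV := activation_one_le_sum hm hAB hA hB
  rw [hfar, Finset.sum_union hdisj]
  rcases R.eq_empty_or_nonempty with hRe | ⟨r, hr⟩
  · rw [hRe, Finset.sum_empty, zero_add]
    calc _ ≤ activation m 1 * τ := mul_le_mul_of_nonneg_left hL hΦ
      _ ≤ _ := mul_le_mul_of_nonneg_right hV hτ0
  rcases L.eq_empty_or_nonempty with hLe | ⟨l, hl⟩
  · rw [hLe, Finset.sum_empty, add_zero]
    calc _ ≤ activation m 1 * τ := mul_le_mul_of_nonneg_left hR hΦ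
      _ ≤ _ := mul_le_mul_of_nonneg_right hV hτ0
  obtain ⟨hr1, hr2⟩ := Finset.mem_filter.1 hr
  obtain ⟨hl1, hl2⟩ := Finset.mem_filter.1 hl
  have hr3 : (r : ℝ) ≤ B := by exact_mod_cast (Finset.mem_Icc.1 hr1).2
  have hl3 : (A : ℝ) ≤ l := by exact_mod_cast (Finset.mem_Icc.1 hl1).1
  -- Nodes beyond z ± T with T > 2 force A ≤ z and z + 1 ≤ B, so both integers around `z` are nodes.
  have hV2 := two_mul_activation_one_le_sum (m := m) hm (A := A) (B := B) (z := z)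
    (by linarith) (by linarith)
  calc _ ≤ activation m 1 * (τ + τ) := mul_le_mul_of_nonneg_left (add_le_add hR hL) hΦ
    _ = (2 * activation m 1) * τ := by ring
    _ ≤ _ := mul_le_mul_of_nonneg_right hV2 hτ0

lemma activation_one_pos (m : ℕ) : 0 < activation m 1 := by
  rw [activation_one]; positivity

lemma activation_one_le_one {m : ℕ} (hm : 1 ≤ m) : activation m 1 ≤ 1 := by
  have h1 := sigmoidGen_le_one hm (1 + 1)
  have h2 : sigmoidGen m (1 - 1) = 0 := by simp [sigmoidGen]
  rw [activation, h2]; norm_num at h1 ⊢; linarith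

/-! ### Error of the operator and its limit -/

lemma abs_neuralOp_sub_le {m n : ℕ} (hm : 1 ≤ m) {a b x : ℝ} (hx : x ∈ Icc a b) {f : ℝ → ℝ}
    (hAB : ⌈(n : ℝ) * a⌉ ≤ ⌊(n : ℝ) * b⌋) {T E₁ E₂ : ℝ} (hT : 2 < T) (hE₁ : 0 ≤ E₁) (hE₂ : 0 ≤ E₂)
    (hnear : ∀ k ∈ Finset.Icc ⌈(n : ℝ) * a⌉ ⌊(n : ℝ) * b⌋, |(n : ℝ) * x - ((k : ℤ) : ℝ)| ≤ T →
      |f (k / n) - f x| ≤ E₁)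
    (hfar : ∀ k ∈ Finset.Icc ⌈(n : ℝ) * a⌉ ⌊(n : ℝ) * b⌋, |f (((k : ℤ) : ℝ) / n) - f x| ≤ E₂) :
    |neuralOp m a b n f x - f x| ≤
      1 / activation m 1 * (E₁ + E₂ * (1 / (4 * m * (T - 2) ^ (2 * m)))) := by
  set z := (n : ℝ) * x
  have hna : (n : ℝ) * a ≤ z := mul_le_mul_of_nonneg_left hx.1 n.cast_nonneg
  have hnb : z ≤ (n : ℝ) * b := mul_le_mul_of_nonneg_left hx.2 n.cast_nonneg
  have hA : ((⌈(n : ℝ) * a⌉ : ℤ) : ℝ) < z + 1 := by linarith [Int.ceil_lt_add_one ((n : ℝ) * a)]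
  have hB : z - 1 < ((⌊(n : ℝ) * b⌋ : ℤ) : ℝ) := by linarith [Int.sub_one_lt_floor ((n : ℝ) * b)]
  have key := activation_one_mul_sum_far_le hm hT hAB hA hB
  have hV := activation_one_le_sum hm hAB hA hB
  have hΦ := activation_one_pos m
  have hΦ1 := activation_one_le_one hm
  rw [neuralOp]
  set S := Finset.Icc ⌈(n : ℝ) * a⌉ ⌊(n : ℝ) * b⌋
  set V := ∑ k ∈ S, activation m (z - k)
  set τ := 1 / (4 * (m : ℝ) * (T - 2) ^ (2 * m))
  have hV0 : 0 < V := hΦ.trans_le hV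
  have e : (∑ k ∈ S, f ((k : ℝ) / n) * activation m (z - k)) / V - f x =
      (∑ k ∈ S, (f ((k : ℝ) / n) - f x) * activation m (z - k)) / V := by
    simp_rw [sub_mul, Finset.sum_sub_distrib, ← Finset.mul_sum]
    rw [sub_div, mul_div_cancel_right₀ _ hV0.ne']
  have hsum : |∑ k ∈ S, (f ((k : ℝ) / n) - f x) * activation m (z - k)| ≤
      E₁ * V + E₂ * ∑ k ∈ S with (T < |z - ((k : ℤ) : ℝ)|), activation m (z - k) := by
    refine (Finset.abs_sum_le_sum_abs _ _).trans ?_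
    rw [Finset.sum_filter, Finset.mul_sum, Finset.mul_sum, ← Finset.sum_add_distrib]
    refine Finset.sum_le_sum fun k hk => ?_
    have h0 := activation_nonneg hm (z - k)
    rw [abs_mul, abs_of_nonneg h0]
    split_ifs with h
    · have := mul_le_mul_of_nonneg_right (hfar k hk) h0
      have := mul_nonneg hE₁ h0
      linarith
    · have := mul_le_mul_of_nonneg_right (hnear k hk (not_lt.1 h)) h0
      linarith
  rw [e, abs_div, abs_of_pos hV0, div_le_iff₀ hV0, one_div_mul_eq_div, div_mul_eq_mul_div,
    le_div_iff₀ hΦ]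
  set F := ∑ k ∈ S with (T < |z - ((k : ℤ) : ℝ)|), activation m (z - k)
  calc _ ≤ (E₁ * V + E₂ * F) * activation m 1 := mul_le_mul_of_nonneg_right hsum hΦ.le
    _ = E₁ * V * activation m 1 + E₂ * (activation m 1 * F) := by ring
    -- Φ(1) ≤ 1 lets the near term share the factor 1/Φ(1) of the far term.
    _ ≤ E₁ * V * 1 + E₂ * (V * τ) := by gcongr
    _ = _ := by ring

lemma tendsto_natCast_rpow_atTop {c : ℝ} (hc : 0 < c) :
    Filter.Tendsto (fun n : ℕ => (n : ℝ) ^ c) Filter.atTop Filter.atTop :=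
  (tendsto_rpow_atTop hc).comp tendsto_natCast_atTop_atTop

lemma eventually_ceil_mul_le_floor_mul {a b : ℝ} (hab : a < b) :
    ∀ᶠ n : ℕ in Filter.atTop, ⌈(n : ℝ) * a⌉ ≤ ⌊(n : ℝ) * b⌋ := by
  filter_upwards [(tendsto_natCast_atTop_atTop (R := ℝ)).eventually_ge_atTop (1 / (b - a))]
    with n hn
  have h1 := (div_le_iff₀ (sub_pos.2 hab)).1 hn
  refine Int.le_floor.2 ?_
  linarith [Int.ceil_lt_add_one ((n : ℝ) * a)]

theorem theorem37 (α a b x : ℝ) (hα0 : 0 < α) (hα1 : α < 1) (hab : a < b)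
    (hx : x ∈ Set.Icc a b) (N m : ℕ) (hN : 1 ≤ N) (hm : 1 ≤ m) (f : ℝ → ℝ)
    (hf : ContinuousOn f (Set.Icc a b))
    -- `f' ∈ L_∞([a, b])`
    (hfac : AbsolutelyContinuousOnInterval f a b)
    (hf' : MeasureTheory.MemLp (deriv f) ⊤ (MeasureTheory.volume.restrict (Set.Icc a b)))
    -- the iterated derivatives are defined: each function that gets differentiated has an
    -- integrable derivative (as an absolutely continuous function)
    (hLac : ∀ k : ℕ, 1 ≤ k → k ≤ N → AbsolutelyContinuousOnInterval (iterCaputoLeft α x k f) x b)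
    (hRac : ∀ k : ℕ, 1 ≤ k → k ≤ N → AbsolutelyContinuousOnInterval (iterCaputoRight α x k f) a x)
    (hLcont : ∀ k : ℕ, k ≤ N + 1 → ContinuousOn (iterCaputoLeft α x k f) (Set.Icc x b))
    (hLzero : ∀ i : ℕ, 2 ≤ i → i ≤ N + 1 → iterCaputoLeft α x i f x = 0)
    (hRcont : ∀ k : ℕ, k ≤ N + 1 → ContinuousOn (iterCaputoRight α x k f) (Set.Icc a x))
    (hRzero : ∀ i : ℕ, 2 ≤ i → i ≤ N + 1 → iterCaputoRight α x i f x = 0) :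
    (∀ n : ℕ, 2 < (n : ℝ) ^ (1 - α) → ⌈(n : ℝ) * a⌉ ≤ ⌊(n : ℝ) * b⌋ → ∀ δ : ℝ, 0 < δ →
      |neuralOp m a b n f x - f x| ≤
        2 * (1 + 4 ^ m : ℝ) ^ (1 / (2 * (m : ℝ))) * caputoModulus α a b x (N + 1) f δ /
            Real.Gamma (((N : ℝ) + 1) * α + 1) *
          ((1 / (n : ℝ) ^ (((N : ℝ) + 1) * α ^ 2) +
              (b - a) ^ (((N : ℝ) + 1) * α) /
                (4 * (m : ℝ) * ((n : ℝ) ^ (1 - α) - 2) ^ (2 * m))) +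
            1 / (δ * (((N : ℝ) + 1) * α + 1)) *
              (1 / (n : ℝ) ^ (α * (((N : ℝ) + 1) * α + 1)) +
                (b - a) ^ (((N : ℝ) + 1) * α + 1) /
                  (4 * (m : ℝ) * ((n : ℝ) ^ (1 - α) - 2) ^ (2 * m))))) ∧
    Filter.Tendsto (fun n : ℕ => neuralOp m a b n f x) Filter.atTop (nhds (f x)) := by
  have hν : 0 < ((N : ℝ) + 1) * α := by positivity
  have hm' : (1 : ℝ) ≤ m := by exact_mod_cast hm
  have hΓ : 0 < Real.Gamma (((N : ℝ) + 1) * α + 1) := Real.Gamma_pos_of_pos (by linarith)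
  have main : ∀ n : ℕ, 2 < (n : ℝ) ^ (1 - α) → ⌈(n : ℝ) * a⌉ ≤ ⌊(n : ℝ) * b⌋ → ∀ δ : ℝ, 0 < δ →
      |neuralOp m a b n f x - f x| ≤
        2 * (1 + 4 ^ m : ℝ) ^ (1 / (2 * (m : ℝ))) * caputoModulus α a b x (N + 1) f δ /
            Real.Gamma (((N : ℝ) + 1) * α + 1) *
          ((1 / (n : ℝ) ^ (((N : ℝ) + 1) * α ^ 2) +
              (b - a) ^ (((N : ℝ) + 1) * α) /
                (4 * (m : ℝ) * ((n : ℝ) ^ (1 - α) - 2) ^ (2 * m))) +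
            1 / (δ * (((N : ℝ) + 1) * α + 1)) *
              (1 / (n : ℝ) ^ (α * (((N : ℝ) + 1) * α + 1)) +
                (b - a) ^ (((N : ℝ) + 1) * α + 1) /
                  (4 * (m : ℝ) * ((n : ℝ) ^ (1 - α) - 2) ^ (2 * m)))) := by
    intro n hn hAB δ hδ
    have hn0 : (0 : ℝ) < n := by
      rcases Nat.eq_zero_or_pos n with rfl | h
      · rw [Nat.cast_zero, Real.zero_rpow (by linarith)] at hn
        linarith
      · exact_mod_cast h
    have hω := caputoModulus_nonneg α a b x (N + 1) f δ
    have hmem : ∀ k ∈ Finset.Icc ⌈(n : ℝ) * a⌉ ⌊(n : ℝ) * b⌋, ((k : ℤ) : ℝ) / n ∈ Icc a b := by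
      intro k hk
      obtain ⟨h1, h2⟩ := Finset.mem_Icc.1 hk
      have h1' := Int.ceil_le.1 h1
      have h2' := Int.le_floor.1 h2
      exact ⟨by rw [le_div_iff₀ hn0]; linarith, by rw [div_le_iff₀ hn0]; linarith⟩
    have hest : ∀ d : ℝ, ∀ k ∈ Finset.Icc ⌈(n : ℝ) * a⌉ ⌊(n : ℝ) * b⌋,
        |((k : ℤ) : ℝ) / n - x| ≤ d → |f (((k : ℤ) : ℝ) / n) - f x| ≤
          caputoModulus α a b x (N + 1) f δ / Real.Gamma (((N : ℝ) + 1) * α + 1) *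
            (d ^ (((N : ℝ) + 1) * α) +
              d ^ (((N : ℝ) + 1) * α + 1) / (δ * (((N : ℝ) + 1) * α + 1))) := by
      intro d k hk hd
      refine (abs_sub_le_of_caputoModulus hα0 hα1 hδ hx (hmem k hk) hfac hLac hRac hLcont
        hRcont).trans ?_
      gcongr
    have hE : ∀ d : ℝ, 0 ≤ d → 0 ≤
          caputoModulus α a b x (N + 1) f δ / Real.Gamma (((N : ℝ) + 1) * α + 1) *
            (d ^ (((N : ℝ) + 1) * α) +
              d ^ (((N : ℝ) + 1) * α + 1) / (δ * (((N : ℝ) + 1) * α + 1))) := by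
      intro d hd; positivity
    have hd0 : (0 : ℝ) ≤ (n : ℝ) ^ (-α) := by positivity
    -- Here T = n^(1-α): near nodes satisfy |k/n - x| ≤ n^(-α), and b - a serves for all nodes.
    have h := abs_neuralOp_sub_le hm hx (f := f) hAB hn (hE _ hd0)
      (hE (b - a) (by linarith)) (fun k hk hk' => hest _ k hk ?_) (fun k hk => hest _ k hk ?_)
    · refine h.trans (le_of_eq ?_)
      rw [activation_one, one_div_one_div, ← Real.rpow_mul hn0.le, ← Real.rpow_mul hn0.le,
        show -α * (((N : ℝ) + 1) * α) = -(((N : ℝ) + 1) * α ^ 2) by ring,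
        show -α * (((N : ℝ) + 1) * α + 1) = -(α * (((N : ℝ) + 1) * α + 1)) by ring,
        Real.rpow_neg hn0.le, Real.rpow_neg hn0.le]
      ring
    · have e : (k : ℝ) / n - x = -(((n : ℝ) * x - k) / n) := by field_simp; ring
      rw [e, abs_neg, abs_div, abs_of_pos hn0, div_le_iff₀ hn0, ← Real.rpow_add_one hn0.ne']
      rwa [neg_add_eq_sub]
    · have := hmem k hk
      rw [abs_le]
      constructor <;> linarith [this.1, this.2, hx.1, hx.2]
  refine ⟨main, ?_⟩
  have hT := tendsto_natCast_rpow_atTop (show 0 < 1 - α by linarith)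
  have hfar : ∀ c : ℝ, Filter.Tendsto
      (fun n : ℕ => c / (4 * (m : ℝ) * ((n : ℝ) ^ (1 - α) - 2) ^ (2 * m))) Filter.atTop
      (nhds 0) := fun c =>
    (((Filter.tendsto_pow_atTop (by omega)).comp
      (Filter.tendsto_atTop_add_const_right _ (-2) hT)).const_mul_atTop
      (by positivity)).const_div_atTop c
  have hnear : ∀ c : ℝ, 0 < c → Filter.Tendsto (fun n : ℕ => 1 / (n : ℝ) ^ c) Filter.atTop
      (nhds 0) := fun c hc => (tendsto_natCast_rpow_atTop hc).const_div_atTop 1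
  -- With δ = 1 fixed the modulus is a constant factor, and the braces alone tend to 0.
  have hlim := (((hnear (((N : ℝ) + 1) * α ^ 2) (by positivity)).add
    (hfar ((b - a) ^ (((N : ℝ) + 1) * α)))).add
    (((hnear (α * (((N : ℝ) + 1) * α + 1)) (by positivity)).add
      (hfar ((b - a) ^ (((N : ℝ) + 1) * α + 1)))).const_mul
        (1 / (1 * (((N : ℝ) + 1) * α + 1))))).const_mul
    (2 * (1 + 4 ^ m : ℝ) ^ (1 / (2 * (m : ℝ))) * caputoModulus α a b x (N + 1) f 1 /
      Real.Gamma (((N : ℝ) + 1) * α + 1))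
  simp only [add_zero, mul_zero] at hlim
  rw [tendsto_iff_norm_sub_tendsto_zero]
  refine squeeze_zero' (Filter.Eventually.of_forall fun _ => norm_nonneg _) ?_ hlim
  filter_upwards [hT.eventually_gt_atTop 2, eventually_ceil_mul_le_floor_mul hab] with n h1 h2
  exact main n h1 h2 1 one_pos
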